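/- Let $A$ be any commutative ring with $1$. Let $\mathrm{GE}_2(A)\subseteq \mathrm{GL}_2(A)$ be the subgroup generated by the elementary matrices $E_{12}(t)$, $E_{21}(t)$ ($t\in A$) and the invertible diagonal matrices, and let $\mathrm{PGE}_2(A)=\mathrm{GE}_2(A)/A^\times I_2$. Let $\mathrm{St}(2,A)$ be the group with generators $x_{12}(t),x_{21}(t)$ ($t\in A$) and relations $x_{ij}(r)x_{ij}(s)=x_{ij}(r+s)$ and $w_{ij}(u)x_{ji}(r)w_{ij}(u)^{-1}=x_{ij}(-u^2r)$ for $r,s\in A$, $u\in A^\times$, where $w_{ij}(u)=x_{ij}(u)x_{ji}(-u^{-1})x_{ij}(u)$. Let $K_2(2,A)$ be the kernel of $\mathrm{St}(2,A)\to \mathrm{GE}_2(A)$, $x_{ij}(t)\mapsto E_{ij}(t)$. Put $h_{12}(u)=w_{12}(u)w_{12}(-1)$, and let $C(2,A)\subseteq K_2(2,A)$ be the (central) subgroup generated by the Steinberg symbols $\{u,v\}=h_{12}(uv)h_{12}(u)^{-1}h_{12}(v)^{-1}$, $u,v\in A^\times$. The group $A^\times$ acts on $\mathrm{St}(2,A)$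 by $a\cdot x_{12}(t)=x_{12}(at)$, $a\cdot x_{21}(t)=x_{21}(a^{-1}t)$. Let $\mathrm{GSt}(2,A)=\mathrm{St}(2,A)\rtimes A^\times$; it maps onto $\mathrm{GE}_2(A)$ by $x_{ij}(t)\mapsto E_{ij}(t)$, $a\mapsto\mathrm{diag}(a,1)$, with kernel $K_2(2,A)$. Conjugation in $\mathrm{GSt}(2,A)$ induces an action of $\mathrm{PGE}_2(A)$ on $\big(K_2(2,A)/C(2,A)\big)^{\mathrm{ab}}$; a subscript $\mathrm{PGE}_2(A)$ denotes coinvariants. Let $A_{A^\times}$ be the quotient of $A$ by the ideal generated by all $a-1$, $a\in A^\times$, let $\mathcal G_A=A^\times/(A^\times)^2$, and let $$\kappa:\Big(\frac{K_2(2,A)}{C(2,A)}\Big)^{\mathrm{ab}}_{\mathrm{PGE}_2(A)}\to A_{A^\times}$$ be the map induced by the homomorphism $\mathrm{St}(2,A)\to A_{A^\times}$ that sends both $x_{12}(t)$ and $x_{21}(t)$ to the class of $t$. Then there is an exact sequence $$H_2(\mathrm{PGE}_2(A),\mathbb Z)\xrightarrow{\ \delta\ }\Big(\frac{K_2(2,A)}{C(2,A)}\Big)^{\mathrm{ab}}_{\mathrm{PGE}_2(A)}\xrightarrow{\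 \kappa\ }A_{A^\times}\to H_1(\mathrm{PGE}_2(A),\mathbb Z)\to \mathcal G_A\to 1,$$ in which $A_{A^\times}\to H_1(\mathrm{PGE}_2(A),\mathbb Z)$ sends the class of $t$ to the class of $E_{12}(t)$, the map $H_1(\mathrm{PGE}_2(A),\mathbb Z)\to\mathcal G_A$ is induced by the determinant, and $\delta$ is the connecting map of the extension of $\mathrm{PGE}_2(A)$ by $K_2(2,A)/C(2,A)$ that is obtained from $\mathrm{GSt}(2,A)$ by dividing out $C(2,A)$ and the elements $(h_{12}(a^{-1}),a^2)$, $a\in A^\times$ (lifts of the matrices $aI_2$): it sends the class of a $2$-cycle $\sum n_i(g_i,h_i)$ to $\sum n_i[c(g_i,h_i)]$, where $c$ is the factor set of a set-theoretic section $s$, that is $s(g)s(h)=c(g,h)s(gh)$. Moreover the map $H_1(\mathrm{PGE}_2(A),\mathbb Z)\to\mathcal G_A$ has a splitting homomorphism $\mathcal G_A\to H_1(\mathrm{PGE}_2(A),\mathbb Z)$. -/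

import Mathlib

namespace GETwo

universe u

noncomputable section

/-! ### Elementary matrices, `GE₂(A)` and `PGE₂(A)`

Indices are written as Booleans: `false` stands for `(i, j) = (1, 2)` and `true` for `(2, 1)`,
so that `!i` stands for `(j, i)`. -/

/-- `E₁₂(t)` for `false` and `E₂₁(t)` for `true`. -/
def elem {A : Type u} [CommRing A] : Bool → A → GL (Fin 2) A
  | false, t => ⟨!![1, t; 0, 1], !![1, -t; 0, 1],
      by ext i j; fin_cases i <;> fin_cases j <;> simp [Matrix.mul_apply, Fin.sum_univ_two],
      by ext i j; fin_cases i <;> fin_cases j <;> simp [Matrix.mul_apply, Fin.sum_univ_two]⟩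
  | true, t => ⟨!![1, 0; t, 1], !![1, 0; -t, 1],
      by ext i j; fin_cases i <;> fin_cases j <;> simp [Matrix.mul_apply, Fin.sum_univ_two],
      by ext i j; fin_cases i <;> fin_cases j <;> simp [Matrix.mul_apply, Fin.sum_univ_two]⟩

/-- The invertible diagonal matrix `diag(a, b)`. -/
def diag {A : Type u} [CommRing A] (a b : Aˣ) : GL (Fin 2) A :=
  ⟨!![(a : A), 0; 0, (b : A)], !![((a⁻¹ : Aˣ) : A), 0; 0, ((b⁻¹ : Aˣ) : A)],
    by ext i j; fin_cases i <;> fin_cases j <;> simp [Matrix.mul_apply, Fin.sum_univ_two],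
    by ext i j; fin_cases i <;> fin_cases j <;> simp [Matrix.mul_apply, Fin.sum_univ_two]⟩

/-- `GE₂(A)`: the subgroup of `GL₂(A)` generated by the elementary and the diagonal matrices. -/
def GE (A : Type u) [CommRing A] : Subgroup (GL (Fin 2) A) :=
  Subgroup.closure ((Set.range fun p : Bool × A => elem p.1 p.2) ∪
    (Set.range fun p : Aˣ × Aˣ => diag p.1 p.2))

/-- The group `Aˣ I₂` of scalar matrices. -/
def scalars (A : Type u) [CommRing A] : Subgroup (GL (Fin 2) A) :=
  (Matrix.GeneralLinearGroup.scalar (Fin 2) : Aˣ →* GL (Fin 2) A).range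

instance scalars_normal (A : Type u) [CommRing A] : (scalars A).Normal := by
  unfold scalars
  rw [← Matrix.GeneralLinearGroup.center_eq_range_scalar]
  infer_instance

/-- `PGE₂(A) = GE₂(A) / Aˣ I₂`. -/
abbrev PGE (A : Type u) [CommRing A] : Type u := GE A ⧸ (scalars A).subgroupOf (GE A)

/-- `E_{ij}(t)` as an element of `GE₂(A)`. -/
def elemGE {A : Type u} [CommRing A] (i : Bool) (t : A) : GE A :=
  ⟨elem i t, Subgroup.subset_closure (Or.inl ⟨(i, t), rfl⟩)⟩

/-- `diag(a, b)` as an element of `GE₂(A)`. -/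
def diagGE {A : Type u} [CommRing A] (a b : Aˣ) : GE A :=
  ⟨diag a b, Subgroup.subset_closure (Or.inr ⟨(a, b), rfl⟩)⟩

/-! ### The Steinberg group `St(2, A)`, `K₂(2, A)` and `C(2, A)` -/

/-- `w_{ij}(u) = x_{ij}(u) x_{ji}(-u⁻¹) x_{ij}(u)`, for elements `x_{ij}(t)` of any group. -/
def wElt {A : Type u} [CommRing A] {G : Type*} [Group G] (x : Bool → A → G) (i : Bool) (u : Aˣ) :
    G :=
  x i u * x (!i) (-((u⁻¹ : Aˣ) : A)) * x i u

/-- `h_{ij}(u) = w_{ij}(u) w_{ij}(-1)`, for elements `x_{ij}(t)` of any group. -/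
def hElt {A : Type u} [CommRing A] {G : Type*} [Group G] (x : Bool → A → G) (i : Bool) (u : Aˣ) :
    G :=
  wElt x i u * wElt x i (-1)

/-- The generator `x_{ij}(t)` in the free group. -/
def freeX {A : Type u} (i : Bool) (t : A) : FreeGroup (Bool × A) := FreeGroup.of (i, t)

/-- The defining relators of `St(2, A)`:
`x_{ij}(r) x_{ij}(s) = x_{ij}(r + s)` and `w_{ij}(u) x_{ji}(r) w_{ij}(u)⁻¹ = x_{ij}(-u² r)`. -/
def steinbergRels (A : Type u) [CommRing A] : Set (FreeGroup (Bool × A)) :=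
  {z | ∃ (i : Bool) (r s : A), z = freeX i r * freeX i s * (freeX i (r + s))⁻¹} ∪
  {z | ∃ (i : Bool) (u : Aˣ) (r : A),
    z = wElt freeX i u * freeX (!i) r * (wElt freeX i u)⁻¹ * (freeX i (-(u : A) ^ 2 * r))⁻¹}

/-- The Steinberg group `St(2, A)`. -/
abbrev St (A : Type u) [CommRing A] : Type u := PresentedGroup (steinbergRels A)

/-- The generator `x_{ij}(t)` of `St(2, A)`. -/
def stX {A : Type u} [CommRing A] (i : Bool) (t : A) : St A := PresentedGroup.of (i, t)

section Maps

variable {A : Type u} [CommRing A] {G H : Type*} [Group G] [Group H]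

theorem map_wElt (f : G →* H) (x : Bool → A → G) (i : Bool) (u : Aˣ) :
    f (wElt x i u) = wElt (fun i t => f (x i t)) i u := by
  simp [wElt]

theorem map_hElt (f : G →* H) (x : Bool → A → G) (i : Bool) (u : Aˣ) :
    f (hElt x i u) = hElt (fun i t => f (x i t)) i u := by
  simp [hElt, map_wElt]

theorem stX_add (i : Bool) (r s : A) : stX i (r + s) = stX i r * stX i s := by
  have h : PresentedGroup.mk (steinbergRels A) (freeX i r * freeX i s * (freeX i (r + s))⁻¹) = 1 :=
    PresentedGroup.one_of_mem (Or.inl ⟨i, r, s, rfl⟩)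
  rw [map_mul, map_mul, map_inv, mul_inv_eq_one] at h
  exact h.symm

theorem stX_conj (i : Bool) (u : Aˣ) (r : A) :
    wElt stX i u * stX (!i) r * (wElt stX i u)⁻¹ = stX i (-(u : A) ^ 2 * r) := by
  have h := PresentedGroup.one_of_mem (rels := steinbergRels A) (Or.inr ⟨i, u, r, rfl⟩)
  rw [map_mul, map_mul, map_mul, map_inv, map_inv, mul_inv_eq_one, map_wElt] at h
  exact h

/-- A homomorphism out of `St(2, A)` from elements that satisfy the two families of relations. -/
def stLift (x : Bool → A → G) (hadd : ∀ i r s, x i r * x i s = x i (r + s))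
    (hconj : ∀ i (u : Aˣ) r,
      wElt x i u * x (!i) r * (wElt x i u)⁻¹ = x i (-(u : A) ^ 2 * r)) : St A →* G :=
  PresentedGroup.toGroup (f := fun p => x p.1 p.2) (by
    rintro z (⟨i, r, s, rfl⟩ | ⟨i, u, r, rfl⟩)
    · simp [freeX, hadd]
    · rw [map_mul, map_mul, map_mul, map_inv, map_inv, mul_inv_eq_one, map_wElt]
      simpa [freeX] using hconj i u r)

@[simp]
theorem stLift_stX (x : Bool → A → G) (hadd hconj) (i : Bool) (t : A) :
    stLift x hadd hconj (stX i t) = x i t :=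
  PresentedGroup.toGroup.of _

theorem st_hom_ext {f g : St A →* G} (h : ∀ i t, f (stX i t) = g (stX i t)) : f = g :=
  PresentedGroup.ext fun p => h p.1 p.2

end Maps

section Steinberg

variable {A : Type u} [CommRing A]

theorem elemGE_add (i : Bool) (r s : A) : elemGE i r * elemGE i s = elemGE i (r + s) := by
  apply Subtype.ext
  apply Units.ext
  cases i <;> ext k l <;> fin_cases k <;> fin_cases l <;>
    simp [elemGE, elem, Matrix.mul_apply, Fin.sum_univ_two, add_comm]

theorem elemGE_conj (i : Bool) (u : Aˣ) (r : A) :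
    wElt elemGE i u * elemGE (!i) r * (wElt elemGE i u)⁻¹ = elemGE i (-(u : A) ^ 2 * r) := by
  rw [mul_inv_eq_iff_eq_mul]
  have hu : (u : A) * ((u⁻¹ : Aˣ) : A) = 1 := u.mul_inv
  apply Subtype.ext
  apply Units.ext
  cases i <;> ext k l <;> fin_cases k <;> fin_cases l <;>
    simp [wElt, elemGE, elem, Matrix.mul_apply, Fin.sum_univ_two] <;> grind

/-- The map `φ : St(2, A) → GE₂(A)`, `x_{ij}(t) ↦ E_{ij}(t)`, whose image is `E₂(A)`. -/
def phi (A : Type u) [CommRing A] : St A →* GE A := stLift elemGE elemGE_add elemGE_conj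

/-- `K₂(2, A)`, the kernel of `φ`. -/
def K2 (A : Type u) [CommRing A] : Subgroup (St A) := (phi A).ker

instance K2_normal : (K2 A).Normal := by unfold K2; infer_instance

/-- `h₁₂(u)` in `St(2, A)`. -/
def stH (u : Aˣ) : St A := hElt stX false u

/-- The Steinberg symbol `{u, v} = h₁₂(uv) h₁₂(u)⁻¹ h₁₂(v)⁻¹`. -/
def symb (u v : Aˣ) : St A := stH (u * v) * (stH u)⁻¹ * (stH v)⁻¹

/-- `C(2, A)`, the subgroup generated by the Steinberg symbols. -/
def C2 (A : Type u) [CommRing A] : Subgroup (St A) :=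
  Subgroup.closure (Set.range fun p : Aˣ × Aˣ => symb p.1 p.2)

theorem stX_zero (i : Bool) : stX i (0 : A) = 1 := by
  have h := stX_add i (0 : A) 0
  rwa [add_zero, left_eq_mul] at h

theorem stX_neg (i : Bool) (t : A) : stX i (-t) = (stX i t)⁻¹ := by
  rw [eq_inv_iff_mul_eq_one, ← stX_add, neg_add_cancel, stX_zero]

theorem stW_neg (i : Bool) (u : Aˣ) : wElt stX i (-u) = (wElt stX i u)⁻¹ := by
  simp [wElt, stX_neg, mul_assoc]

theorem stX_conj' (i : Bool) (u : Aˣ) (r : A) :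
    wElt stX i u * stX i r * (wElt stX i u)⁻¹ = stX (!i) (-((u⁻¹ : Aˣ) : A) ^ 2 * r) := by
  have h := stX_conj i (-u) (-((u⁻¹ : Aˣ) : A) ^ 2 * r)
  have hu : (u : A) * ((u⁻¹ : Aˣ) : A) = 1 := u.mul_inv
  have e : -((-u : Aˣ) : A) ^ 2 * (-((u⁻¹ : Aˣ) : A) ^ 2 * r) = r := by
    push_cast
    linear_combination (r * ((u : A) * ((u⁻¹ : Aˣ) : A) + 1)) * hu
  rw [stW_neg, e, inv_inv] at h
  rw [← h]
  group

/-- The scalar by which `diag(a, 1)` acts on `E_{ij}(t)` by conjugation. -/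
def sc (i : Bool) (a : Aˣ) : Aˣ := if i then a⁻¹ else a

theorem sc_not (i : Bool) (a : Aˣ) : sc (!i) a = (sc i a)⁻¹ := by
  cases i <;> simp [sc]

theorem sc_mul (i : Bool) (a b : Aˣ) : sc i (a * b) = sc i a * sc i b := by
  cases i <;> simp [sc, mul_comm]

theorem sc_one (i : Bool) : sc i (1 : Aˣ) = 1 := by
  cases i <;> simp [sc]

theorem stH_conj (u : Aˣ) (i : Bool) (t : A) :
    stH u * stX i t * (stH u)⁻¹ = stX i ((sc i u : A) ^ 2 * t) := by
  have e : stH u * stX i t * (stH u)⁻¹ = wElt stX false u *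
      (wElt stX false (-1) * stX i t * (wElt stX false (-1))⁻¹) * (wElt stX false u)⁻¹ := by
    simp [stH, hElt, mul_assoc]
  rw [e]
  cases i
  · rw [stX_conj', stX_conj false]
    simp [sc]
  · rw [show stX true t = stX (!false) t from rfl, stX_conj, stX_conj']
    simp [sc]

/-- Steinberg symbols are central. -/
theorem symb_central (u v : Aˣ) (s : St A) : symb u v * s = s * symb u v := by
  have h : ((MulAut.conj (symb u v)).toMonoidHom : St A →* St A) = MonoidHom.id _ := by
    apply st_hom_ext
    intro i t
    have e (a : Aˣ) (t : A) :
        (stH a)⁻¹ * stX i t * stH a = stX i (((sc i a)⁻¹ : Aˣ) ^ 2 * t) := by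
      have h := stH_conj a i (((sc i a)⁻¹ : Aˣ) ^ 2 * t)
      rw [← mul_assoc, ← mul_pow, Units.mul_inv, one_pow, one_mul] at h
      rw [← h]
      group
    have e2 : symb u v * stX i t * (symb u v)⁻¹ = stH (u * v) * ((stH u)⁻¹ *
        ((stH v)⁻¹ * stX i t * stH v) * stH u) * (stH (u * v))⁻¹ := by
      simp [symb, mul_assoc]
    change symb u v * stX i t * (symb u v)⁻¹ = stX i t
    rw [e2, e, e, stH_conj, sc_mul]
    congr 1
    have h1 : (sc i u : A) * ((sc i u)⁻¹ : Aˣ) = 1 := Units.mul_inv _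
    have h2 : (sc i v : A) * ((sc i v)⁻¹ : Aˣ) = 1 := Units.mul_inv _
    have h3 : ((sc i u * sc i v : Aˣ) : A) ^ 2 * (((sc i u)⁻¹ : Aˣ) ^ 2 *
        (((sc i v)⁻¹ : Aˣ) ^ 2 * t)) = ((sc i u : A) * ((sc i u)⁻¹ : Aˣ)) ^ 2 *
        ((sc i v : A) * ((sc i v)⁻¹ : Aˣ)) ^ 2 * t := by
      push_cast
      ring
    rw [h3, h1, h2]
    ring
  have := DFunLike.congr_fun h s
  exact mul_inv_eq_iff_eq_mul.mp this

theorem C2_le_center : C2 A ≤ Subgroup.center (St A) := by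
  refine (Subgroup.closure_le _).2 ?_
  rintro _ ⟨p, rfl⟩
  exact Subgroup.mem_center_iff.2 fun s => (symb_central p.1 p.2 s).symm

theorem diagGE_mul (a b c d : Aˣ) : diagGE a b * diagGE c d = diagGE (a * c) (b * d) := by
  apply Subtype.ext
  apply Units.ext
  ext k l; fin_cases k <;> fin_cases l <;>
    simp [diagGE, diag, Matrix.mul_apply, Fin.sum_univ_two]

theorem phi_stH (u : Aˣ) : phi A (stH u) = diagGE u u⁻¹ := by
  rw [stH, map_hElt]
  apply Subtype.ext
  apply Units.ext
  ext k l; fin_cases k <;> fin_cases l <;>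
    simp [hElt, wElt, phi, diagGE, diag, elemGE, elem, Matrix.mul_apply, Fin.sum_univ_two]

theorem symb_mem_K2 (u v : Aˣ) : symb u v ∈ K2 A := by
  change phi A _ = 1
  rw [symb, map_mul, map_mul, map_inv, map_inv, phi_stH, phi_stH, phi_stH, mul_inv_eq_one,
    mul_inv_eq_iff_eq_mul, diagGE_mul, mul_comm u v, mul_inv]

theorem C2_le_K2 : C2 A ≤ K2 A := by
  refine (Subgroup.closure_le _).2 ?_
  rintro _ ⟨p, rfl⟩
  exact symb_mem_K2 p.1 p.2

/-- `C(2, A)` as a subgroup of `K₂(2, A)`. -/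
abbrev C2K (A : Type u) [CommRing A] : Subgroup (K2 A) := (C2 A).subgroupOf (K2 A)

instance C2K_normal : (C2K A).Normal where
  conj_mem n hn g := by
    have h : (g : St A) * n = n * g := Subgroup.mem_center_iff.1 (C2_le_center hn) g
    have h' : g * n = n * g := Subtype.ext h
    rwa [h', mul_inv_cancel_right]

/-! ### The action of `PGE₂(A)` -/

/-- The endomorphism `x_{12}(t) ↦ x_{12}(a t)`, `x_{21}(t) ↦ x_{21}(a⁻¹ t)` of `St(2, A)`, which
lifts conjugation by `d(a) = diag(a, 1)`. -/
def unitEnd (a : Aˣ) : St A →* St A :=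
  stLift (fun i t => stX i ((sc i a : A) * t))
    (fun i r s => by rw [mul_add, stX_add])
    (fun i u r => by
      have hw : wElt (fun i t => stX i ((sc i a : A) * t)) i u = wElt stX i (sc i a * u) := by
        simp [wElt, sc_not, mul_comm]
      have h := stX_conj i (sc i a * u) (((sc i a)⁻¹ : Aˣ) * r)
      rw [hw, sc_not, h]
      congr 1
      have h1 : (sc i a : A) * ((sc i a)⁻¹ : Aˣ) = 1 := Units.mul_inv _
      push_cast
      linear_combination (-(sc i a : A) * u ^ 2 * r) * h1)

@[simp]
theorem unitEnd_stX (a : Aˣ) (i : Bool) (t : A) :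
    unitEnd a (stX i t) = stX i ((sc i a : A) * t) := by
  simp [unitEnd]

theorem unitEnd_mul (a b : Aˣ) : unitEnd (a * b) = (unitEnd a).comp (unitEnd b : St A →* St A) :=
  st_hom_ext fun i t => by simp [sc_mul, mul_assoc]

theorem unitEnd_one : unitEnd (1 : Aˣ) = MonoidHom.id (St A) :=
  st_hom_ext fun i t => by simp [sc_one]

/-- The action of `d(Aˣ) ≅ Aˣ` on `St(2, A)`. -/
def unitAct (A : Type u) [CommRing A] : Aˣ →* MulAut (St A) where
  toFun a := MonoidHom.toMulEquiv (unitEnd a) (unitEnd a⁻¹)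
    (by rw [← unitEnd_mul, inv_mul_cancel, unitEnd_one])
    (by rw [← unitEnd_mul, mul_inv_cancel, unitEnd_one])
  map_one' := by
    ext s
    exact DFunLike.congr_fun unitEnd_one s
  map_mul' a b := by
    ext s
    exact DFunLike.congr_fun (unitEnd_mul a b) s

theorem unitAct_apply (a : Aˣ) (s : St A) : unitAct A a s = unitEnd a s := rfl

/-- `GSt(2, A) = St(2, A) ⋊ d(Aˣ)`. -/
abbrev GSt (A : Type u) [CommRing A] : Type u := St A ⋊[unitAct A] Aˣ

/-- `d(a) = diag(a, 1)` as a homomorphism `Aˣ → GE₂(A)`. -/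
def dHom (A : Type u) [CommRing A] : Aˣ →* GE A where
  toFun a := diagGE a 1
  map_one' := by
    apply Subtype.ext
    apply Units.ext
    ext k l; fin_cases k <;> fin_cases l <;> simp [diagGE, diag]
  map_mul' a b := by rw [diagGE_mul, one_mul]

theorem phi_unitEnd (a : Aˣ) (s : St A) :
    phi A (unitEnd a s) = dHom A a * phi A s * (dHom A a)⁻¹ := by
  have h : (phi A).comp (unitEnd a) = (MulAut.conj (dHom A a)).toMonoidHom.comp (phi A) := by
    apply st_hom_ext
    intro i t
    have ha : (a : A) * ((a⁻¹ : Aˣ) : A) = 1 := a.mul_inv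
    change phi A (unitEnd a (stX i t)) = dHom A a * phi A (stX i t) * (dHom A a)⁻¹
    rw [eq_mul_inv_iff_mul_eq]
    apply Subtype.ext
    apply Units.ext
    cases i <;> ext k l <;> fin_cases k <;> fin_cases l <;>
      simp [phi, dHom, diagGE, diag, elemGE, elem, sc, Matrix.mul_apply, Fin.sum_univ_two,
        mul_comm]
    all_goals grind
  exact DFunLike.congr_fun h s

/-- The map `Φ : GSt(2, A) → GE₂(A)` that extends `φ`. -/
def Phi (A : Type u) [CommRing A] : GSt A →* GE A :=
  SemidirectProduct.lift (phi A) (dHom A) fun a => by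
    exact MonoidHom.ext fun s => phi_unitEnd a s

theorem Phi_apply (g : GSt A) : Phi A g = phi A g.left * dHom A g.right := rfl

theorem Phi_surjective : Function.Surjective (Phi A) := by
  have hE (i : Bool) (t : A) : elemGE i t ∈ (Phi A).range :=
    ⟨SemidirectProduct.inl (stX i t), by simp [Phi, phi]⟩
  have hD (a b : Aˣ) : diagGE a b ∈ (Phi A).range := by
    refine ⟨⟨stH b⁻¹, a * b⟩, ?_⟩
    rw [Phi_apply, phi_stH]
    change diagGE _ _ * diagGE _ _ = _
    rw [diagGE_mul, mul_comm a b]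
    simp
  rintro ⟨g, hg⟩
  change (⟨g, hg⟩ : GE A) ∈ (Phi A).range
  refine Subgroup.closure_induction (p := fun g hg => (⟨g, hg⟩ : GE A) ∈ (Phi A).range)
    ?_ ?_ ?_ ?_ hg
  · rintro _ (⟨p, rfl⟩ | ⟨p, rfl⟩)
    · exact hE p.1 p.2
    · exact hD p.1 p.2
  · exact one_mem _
  · intro x y hx hy h1 h2
    exact mul_mem h1 h2
  · intro x hx h1
    exact inv_mem h1

/-- Conjugation in `GSt(2, A)`, restricted to `St(2, A)`. -/
def conjSt (A : Type u) [CommRing A] : GSt A →* MulAut (St A) :=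
  SemidirectProduct.lift MulAut.conj (unitAct A) fun a => by
    ext s t
    simp

theorem conjSt_apply (g : GSt A) (s : St A) :
    conjSt A g s = g.left * unitEnd g.right s * g.left⁻¹ := rfl

theorem inl_conjSt (g : GSt A) (s : St A) :
    (SemidirectProduct.inl (conjSt A g s) : GSt A) = g * SemidirectProduct.inl s * g⁻¹ := by
  rw [eq_mul_inv_iff_mul_eq, conjSt_apply]
  ext <;> simp [unitAct_apply]

theorem conjSt_mem_K2 (g : GSt A) {s : St A} (hs : s ∈ K2 A) : conjSt A g s ∈ K2 A := by
  have hs' : phi A s = 1 := hs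
  change phi A _ = 1
  rw [conjSt_apply, map_mul, map_mul, map_inv, phi_unitEnd, hs']
  simp

theorem unitEnd_stH (a u : Aˣ) : unitEnd a (stH u) = stH (a * u) * (stH a)⁻¹ := by
  have hw (u : Aˣ) : unitEnd a (wElt stX false u) = wElt stX false (a * u) := by
    rw [map_wElt]
    simp [wElt, sc, mul_comm]
  rw [stH, hElt, map_mul, hw, hw, stH, hElt, stH, hElt, mul_inv_rev, mul_neg, mul_one, stW_neg,
    mul_assoc, mul_inv_cancel_left]

theorem unitEnd_symb (a u v : Aˣ) :
    unitEnd a (symb u v) = symb (a * u) v * (symb a v)⁻¹ := by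
  have h1 : unitEnd a (symb u v) =
      stH (a * u * v) * (stH (a * u))⁻¹ * (stH a * (stH (a * v))⁻¹) := by
    rw [symb, map_mul, map_mul, map_inv, map_inv, unitEnd_stH, unitEnd_stH, unitEnd_stH]
    simp only [mul_inv_rev, inv_inv, mul_assoc, inv_mul_cancel_left]
  have h2 : symb a v * stH v * stH a = stH (a * v) := by simp [symb]
  have h3 : stH (a * u * v) * (stH (a * u))⁻¹ = symb (a * u) v * stH v := by simp [symb]
  rw [h1, h3, ← h2, mul_inv_rev, mul_inv_rev, mul_inv_cancel_left, mul_assoc, mul_inv_cancel_left]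

theorem conjSt_mem_C2 (g : GSt A) {s : St A} (hs : s ∈ C2 A) : conjSt A g s ∈ C2 A := by
  have h : C2 A ≤ (C2 A).comap (unitEnd g.right) := by
    refine (Subgroup.closure_le _).2 ?_
    rintro _ ⟨p, rfl⟩
    change unitEnd _ (symb _ _) ∈ C2 A
    rw [unitEnd_symb]
    exact mul_mem (Subgroup.subset_closure ⟨(_, _), rfl⟩)
      (inv_mem (Subgroup.subset_closure ⟨(_, _), rfl⟩))
  have h1 : unitEnd g.right s ∈ C2 A := h hs
  have h2 := Subgroup.mem_center_iff.1 (C2_le_center h1) g.left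
  rw [conjSt_apply, h2, mul_inv_cancel_right]
  exact h1

/-- The projection `GSt(2, A) → GE₂(A) → PGE₂(A)`. -/
def proj (A : Type u) [CommRing A] : GSt A →* PGE A :=
  (QuotientGroup.mk' ((scalars A).subgroupOf (GE A))).comp (Phi A)

theorem proj_surjective : Function.Surjective (proj A) :=
  (QuotientGroup.mk'_surjective _).comp Phi_surjective

/-- `K₂(2, A) / C(2, A)`. -/
abbrev KC (A : Type u) [CommRing A] : Type u := K2 A ⧸ C2K A

/-- `(K₂(2, A) / C(2, A))ᵃᵇ`. -/
abbrev KCab (A : Type u) [CommRing A] : Type u := Abelianization (KC A)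

/-- The class in `(K₂(2, A) / C(2, A))ᵃᵇ` of an element of `K₂(2, A)`. -/
def kcMk (A : Type u) [CommRing A] : K2 A →* KCab A :=
  Abelianization.of.comp (QuotientGroup.mk' (C2K A))

theorem kcMk_surjective : Function.Surjective (kcMk A) :=
  (QuotientGroup.mk_surjective (s := commutator (KC A))).comp (QuotientGroup.mk'_surjective _)

/-- Conjugation by an element of `GSt(2, A)` on `K₂(2, A)`. -/
def conjK2 (g : GSt A) : K2 A →* K2 A :=
  ((conjSt A g).toMonoidHom.comp (K2 A).subtype).codRestrict (K2 A)
    fun s => conjSt_mem_K2 g s.2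

theorem coe_conjK2 (g : GSt A) (k : K2 A) : (conjK2 g k : St A) = conjSt A g k := rfl

/-- The endomorphism of `(K₂(2, A) / C(2, A))ᵃᵇ` induced by conjugation in `GSt(2, A)`. -/
def conjKC (g : GSt A) : KCab A →* KCab A :=
  Abelianization.map (QuotientGroup.map (C2K A) (C2K A) (conjK2 g) fun _ hk => conjSt_mem_C2 g hk)

theorem conjKC_kcMk (g : GSt A) (k : K2 A) : conjKC g (kcMk A k) = kcMk A (conjK2 g k) := rfl

theorem conjKC_mul (g h : GSt A) : conjKC (g * h) = (conjKC g).comp (conjKC h) := by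
  refine MonoidHom.ext fun y => ?_
  obtain ⟨k, rfl⟩ := kcMk_surjective y
  have e : conjK2 (g * h) k = conjK2 g (conjK2 h k) :=
    Subtype.ext (by simp only [coe_conjK2, map_mul, MulAut.mul_apply])
  rw [MonoidHom.comp_apply, conjKC_kcMk, conjKC_kcMk, conjKC_kcMk, e]

theorem conjKC_one : conjKC (1 : GSt A) = MonoidHom.id _ := by
  refine MonoidHom.ext fun y => ?_
  obtain ⟨k, rfl⟩ := kcMk_surjective y
  have e : conjK2 (1 : GSt A) k = k :=
    Subtype.ext (by simp only [coe_conjK2, map_one, MulAut.one_apply])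
  rw [conjKC_kcMk, e, MonoidHom.id_apply]

/-- The action of `GSt(2, A)` on `(K₂(2, A) / C(2, A))ᵃᵇ` by conjugation. -/
def gstAct (A : Type u) [CommRing A] : GSt A →* MulAut (KCab A) where
  toFun g := MonoidHom.toMulEquiv (conjKC g) (conjKC g⁻¹)
    (by rw [← conjKC_mul, inv_mul_cancel, conjKC_one])
    (by rw [← conjKC_mul, mul_inv_cancel, conjKC_one])
  map_one' := by
    ext y
    exact DFunLike.congr_fun conjKC_one y
  map_mul' g h := by
    ext y
    exact DFunLike.congr_fun (conjKC_mul g h) y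

theorem gstAct_kcMk (g : GSt A) (k : K2 A) : gstAct A g (kcMk A k) = kcMk A (conjK2 g k) := rfl

theorem gstAct_inl {k : St A} (hk : k ∈ K2 A) : gstAct A (SemidirectProduct.inl k) = 1 := by
  ext y
  obtain ⟨m, rfl⟩ := kcMk_surjective y
  have e : conjK2 (SemidirectProduct.inl k : GSt A) m = ⟨k, hk⟩ * m * (⟨k, hk⟩ : K2 A)⁻¹ :=
    Subtype.ext (by
      rw [coe_conjK2, conjSt_apply]
      simp [unitEnd_one])
  rw [gstAct_kcMk, e, map_mul, map_mul, map_inv, mul_inv_cancel_comm, MulAut.one_apply]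

/-- The lift `(h₁₂(a⁻¹), d(a²))` to `GSt(2, A)` of the scalar matrix `a I₂`. -/
def scalarLift (a : Aˣ) : GSt A := ⟨stH a⁻¹, a ^ 2⟩

theorem conjSt_scalarLift (a : Aˣ) : conjSt A (scalarLift a) = 1 := by
  have h : (conjSt A (scalarLift a)).toMonoidHom = MonoidHom.id (St A) := by
    apply st_hom_ext
    intro i t
    change stH a⁻¹ * unitEnd (a ^ 2) (stX i t) * (stH a⁻¹)⁻¹ = stX i t
    rw [unitEnd_stX, stH_conj, ← mul_assoc]
    have e : (sc i a⁻¹ : A) ^ 2 * (sc i (a ^ 2) : A) = 1 := by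
      norm_cast
      cases i <;> simp [sc]
    rw [e, one_mul]
  ext s
  exact DFunLike.congr_fun h s

theorem gstAct_scalarLift (a : Aˣ) : gstAct A (scalarLift a) = 1 := by
  ext y
  obtain ⟨m, rfl⟩ := kcMk_surjective y
  have e : conjK2 (scalarLift a) m = m :=
    Subtype.ext (by rw [coe_conjK2, conjSt_scalarLift, MulAut.one_apply])
  rw [gstAct_kcMk, e, MulAut.one_apply]

theorem det_phi (s : St A) : Matrix.GeneralLinearGroup.det (phi A s : GL (Fin 2) A) = 1 := by
  have h : Matrix.GeneralLinearGroup.det.comp ((GE A).subtype.comp (phi A)) = 1 := by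
    apply st_hom_ext
    intro i t
    apply Units.ext
    cases i <;> simp [phi, elemGE, elem, Matrix.det_fin_two]
  exact DFunLike.congr_fun h s

theorem scalar_eq_diag (a : Aˣ) : Matrix.GeneralLinearGroup.scalar (Fin 2) a = diag a a := by
  apply Units.ext
  ext k l; fin_cases k <;> fin_cases l <;> simp [diag, Matrix.GeneralLinearGroup.scalar]

theorem det_diag (a b : Aˣ) : Matrix.GeneralLinearGroup.det (diag a b) = a * b := by
  apply Units.ext
  simp [diag, Matrix.det_fin_two]

theorem proj_ker_le : (proj A).ker ≤ (gstAct A).ker := by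
  intro g hg
  have hg1 : ((Phi A g : GE A) : GL (Fin 2) A) ∈ scalars A :=
    Subgroup.mem_subgroupOf.1 ((QuotientGroup.eq_one_iff _).1 hg)
  obtain ⟨b, hb⟩ := hg1
  rw [scalar_eq_diag] at hb
  have hdet := congrArg Matrix.GeneralLinearGroup.det hb
  rw [Phi_apply, Subgroup.coe_mul, map_mul, det_phi, det_diag, one_mul,
    show ((dHom A g.right : GE A) : GL (Fin 2) A) = diag g.right 1 from rfl, det_diag,
    mul_one] at hdet
  have hphi : phi A g.left * dHom A g.right = diagGE b b := Subtype.ext hb.symm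
  have hk : g.left * (stH b⁻¹)⁻¹ ∈ K2 A := by
    change phi A _ = 1
    rw [map_mul, map_inv, mul_inv_eq_one, phi_stH, eq_mul_inv_of_mul_eq hphi,
      mul_inv_eq_iff_eq_mul]
    change _ = diagGE _ _ * diagGE _ _
    rw [diagGE_mul, ← hdet]
    simp
  have hg2 : g = SemidirectProduct.inl (g.left * (stH b⁻¹)⁻¹) * scalarLift b := by
    ext
    · rw [SemidirectProduct.mul_left, SemidirectProduct.left_inl, SemidirectProduct.right_inl,
        map_one, MulAut.one_apply]
      exact (inv_mul_cancel_right _ _).symm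
    · rw [SemidirectProduct.mul_right, SemidirectProduct.right_inl, one_mul, ← hdet, ← pow_two]
      rfl
  rw [MonoidHom.mem_ker, hg2, map_mul, gstAct_inl hk, gstAct_scalarLift, one_mul]

/-- The action of `PGE₂(A)` on `(K₂(2, A) / C(2, A))ᵃᵇ`: the class of a matrix acts by conjugation
with any of its lifts to `GSt(2, A)`. -/
def pgeAct (A : Type u) [CommRing A] : PGE A →* MulAut (KCab A) :=
  (proj A).liftOfSurjective proj_surjective ⟨gstAct A, proj_ker_le⟩

theorem pgeAct_proj (g : GSt A) : pgeAct A (proj A g) = gstAct A g :=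
  MonoidHom.liftOfRightInverse_comp_apply _ _ _ ⟨gstAct A, proj_ker_le⟩ g

/-- `(K₂(2, A) / C(2, A))ᵃᵇ`, written additively, as a representation of `PGE₂(A)` over `ℤ`. -/
def kcRep (A : Type u) [CommRing A] : Representation ℤ (PGE A) (Additive (KCab A)) where
  toFun q := (MonoidHom.toAdditive (pgeAct A q).toMonoidHom).toIntLinearMap
  map_one' := by
    ext y
    simp
  map_mul' p q := by
    ext y
    simp

theorem kcRep_apply (q : PGE A) (y : KCab A) :
    kcRep A q (Additive.ofMul y) = Additive.ofMul (pgeAct A q y) := rfl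

/-- The coinvariants of `PGE₂(A)` on `(K₂(2, A) / C(2, A))ᵃᵇ`. -/
abbrev KCcoinv (A : Type u) [CommRing A] : Type u := (kcRep A).Coinvariants

/-- The class in the coinvariants of an element of `K₂(2, A)`. -/
def kcClass (k : K2 A) : KCcoinv A :=
  Representation.Coinvariants.mk (kcRep A) (Additive.ofMul (kcMk A k))

/-! ### The group `A_{Aˣ}` and the map `κ` -/

/-- The ideal generated by the elements `a - 1` for `a` a unit. -/
def unitIdeal (A : Type u) [CommRing A] : Ideal A :=
  Ideal.span (Set.range fun a : Aˣ => (a : A) - 1)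

/-- `A_{Aˣ}`, the quotient of `A` by the ideal generated by all `a - 1`, `a ∈ Aˣ`. -/
abbrev AU (A : Type u) [CommRing A] : Type u := A ⧸ unitIdeal A

theorem mk_unit (a : Aˣ) : (Ideal.Quotient.mk (unitIdeal A) (a : A)) = 1 := by
  rw [← map_one (Ideal.Quotient.mk (unitIdeal A)), Ideal.Quotient.eq]
  exact Ideal.subset_span ⟨a, rfl⟩

theorem AU_neg_one : (-1 : AU A) = 1 := by
  have h := mk_unit (-1 : Aˣ)
  simpa using h

theorem AU_neg (x : AU A) : -x = x := by
  rw [← neg_one_mul, AU_neg_one, one_mul]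

/-- The homomorphism `f : St(2, A) → A_{Aˣ}` that sends `x₁₂(t)` and `x₂₁(t)` to the class of
`t`. -/
def fSt (A : Type u) [CommRing A] : St A →* Multiplicative (AU A) :=
  stLift (fun _ t => Multiplicative.ofAdd (Ideal.Quotient.mk (unitIdeal A) t))
    (fun i r s => by rw [map_add, ofAdd_add])
    (fun i u r => by
      rw [mul_inv_cancel_comm]
      congr 1
      rw [map_mul, map_neg, map_pow, mk_unit, one_pow, AU_neg, one_mul])

theorem fSt_stX (i : Bool) (t : A) :
    fSt A (stX i t) = Multiplicative.ofAdd (Ideal.Quotient.mk (unitIdeal A) t) := by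
  simp [fSt]

theorem fSt_stH (u : Aˣ) : fSt A (stH u) = 1 := by
  have hw (u : Aˣ) : fSt A (wElt stX false u) = Multiplicative.ofAdd 1 := by
    simp only [wElt, map_mul, fSt_stX, map_neg, mk_unit, AU_neg, ← ofAdd_add]
    congr 1
    nth_rewrite 2 [← AU_neg_one]
    ring
  rw [stH, hElt, map_mul, hw, hw, ← ofAdd_add]
  nth_rewrite 2 [← AU_neg_one]
  rw [add_neg_cancel, ofAdd_zero]

theorem fSt_C2 {s : St A} (hs : s ∈ C2 A) : fSt A s = 1 := by
  have h : C2 A ≤ (fSt A).ker := by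
    refine (Subgroup.closure_le _).2 ?_
    rintro _ ⟨p, rfl⟩
    change fSt A (symb _ _) = 1
    simp [symb, fSt_stH]
  exact h hs

theorem fSt_conjSt (g : GSt A) (s : St A) : fSt A (conjSt A g s) = fSt A s := by
  have h : (fSt A).comp (unitEnd g.right) = fSt A := by
    apply st_hom_ext
    intro i t
    rw [MonoidHom.comp_apply, unitEnd_stX, fSt_stX, fSt_stX, map_mul, mk_unit, one_mul]
  rw [conjSt_apply, map_mul, map_mul, map_inv, mul_inv_cancel_comm]
  exact DFunLike.congr_fun h s

/-- The map induced by `f` on `(K₂(2, A) / C(2, A))ᵃᵇ`. -/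
def kappaAb (A : Type u) [CommRing A] : KCab A →* Multiplicative (AU A) :=
  Abelianization.lift (QuotientGroup.lift (C2K A) ((fSt A).comp (K2 A).subtype)
    fun _ hk => fSt_C2 hk)

theorem kappaAb_kcMk (k : K2 A) : kappaAb A (kcMk A k) = fSt A k := rfl

/-- The map `κ` from the coinvariants of `(K₂(2, A) / C(2, A))ᵃᵇ` to `A_{Aˣ}`. -/
def kappa (A : Type u) [CommRing A] : KCcoinv A →ₗ[ℤ] AU A :=
  Representation.Coinvariants.lift (kcRep A)
    (MonoidHom.toAdditiveLeft (kappaAb A)).toIntLinearMap fun q => by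
      obtain ⟨g, rfl⟩ := proj_surjective q
      refine LinearMap.ext fun y => ?_
      obtain ⟨k, hk⟩ := kcMk_surjective (Additive.toMul y)
      obtain rfl : y = Additive.ofMul (kcMk A k) := by rw [hk]; rfl
      change Multiplicative.toAdd (kappaAb A (pgeAct A (proj A g) (kcMk A k))) =
        Multiplicative.toAdd (kappaAb A (kcMk A k))
      rw [pgeAct_proj, gstAct_kcMk, kappaAb_kcMk, kappaAb_kcMk, coe_conjK2, fSt_conjSt]

theorem kappa_kcClass (k : K2 A) : kappa A (kcClass k) = Multiplicative.toAdd (fSt A k) := rfl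

/-! ### Integral homology and the remaining maps -/

/-- The integral homology group `H_n(G, ℤ)`. -/
abbrev HZ (G : Type u) [Group G] (n : ℕ) : Type u :=
  groupHomology (Rep.trivial (ULift.{u} ℤ) G (ULift.{u} ℤ)) n

/-- The class map `Gᵃᵇ → H₁(G, ℤ)`. -/
def h1Class (G : Type u) [Group G] : Additive (Abelianization G) →+ HZ G 1 :=
  ((groupHomology.mkH1OfIsTrivial (Rep.trivial (ULift.{u} ℤ) G (ULift.{u} ℤ))).flip
    (1 : ULift.{u} ℤ)).toAddMonoidHom

/-- The pairing `(⟦g⟧, n) ↦ n • f g` for a homomorphism `f` from `G` to an abelian group. -/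
def abPairing {G B : Type u} [Group G] [CommGroup B] (f : G →* B) :
    Additive (Abelianization G) →+ ULift.{u} ℤ →+ Additive B where
  toFun x := (zmultiplesHom (Additive B) (MonoidHom.toAdditive (Abelianization.lift f) x)).comp
    (AddEquiv.ulift : ULift.{u} ℤ ≃+ ℤ).toAddMonoidHom
  map_zero' := by ext; simp
  map_add' x y := by ext n; simp

/-- The map `f_* : H₁(G, ℤ) → H₁(B, ℤ) = B` induced by a homomorphism from `G` to an abelian
group `B`; it sends the class of `g` to `f g`. -/
def h1Map {G B : Type u} [Group G] [CommGroup B] (f : G →* B) : HZ G 1 →+ Additive B :=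
  (TensorProduct.liftAddHom (R := ℤ) (abPairing f) fun r x n => by
      rw [map_zsmul, map_zsmul, AddMonoidHom.smul_apply]).comp
    (groupHomology.H1ToTensorOfIsTrivial
      (Rep.trivial (ULift.{u} ℤ) G (ULift.{u} ℤ))).toAddMonoidHom

theorem h1Map_h1Class {G B : Type u} [Group G] [CommGroup B] (f : G →* B) (g : G) :
    h1Map f (h1Class G (Additive.ofMul (Abelianization.of g))) = Additive.ofMul (f g) := by
  have h := groupHomology.H1ToTensorOfIsTrivial_H1π_single
    (A := Rep.trivial (ULift.{u} ℤ) G (ULift.{u} ℤ)) g (1 : ULift.{u} ℤ)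
  refine (congrArg _ h).trans ?_
  exact one_smul ℤ (Additive.ofMul (f g))

/-- `t ↦ E₁₂(t)` as a map from `A` to `PGE₂(A)ᵃᵇ`. -/
def elemAb (A : Type u) [CommRing A] : A →+ Additive (Abelianization (PGE A)) where
  toFun t := Additive.ofMul (Abelianization.of
    (QuotientGroup.mk' ((scalars A).subgroupOf (GE A)) (elemGE false t)))
  map_zero' := by
    have h : elemGE false (0 : A) = 1 := by
      have h := elemGE_add false (0 : A) 0
      rwa [add_zero, mul_eq_right] at h
    rw [h, map_one, map_one, ofMul_one]
  map_add' r s := by rw [← elemGE_add, map_mul, map_mul, ofMul_mul]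

theorem elemAb_unit_mul (a : Aˣ) (t : A) : elemAb A ((a : A) * t) = elemAb A t := by
  have h : elemGE false ((a : A) * t) = dHom A a * elemGE false t * (dHom A a)⁻¹ := by
    have h := phi_unitEnd a (stX false t)
    rw [unitEnd_stX] at h
    simpa [phi, sc] using h
  change Additive.ofMul (Abelianization.of (QuotientGroup.mk' _ (elemGE false _))) =
    Additive.ofMul (Abelianization.of (QuotientGroup.mk' _ (elemGE false _)))
  refine congrArg Additive.ofMul ?_
  rw [h, map_mul, map_mul, map_mul, map_mul, map_inv, map_inv, mul_inv_cancel_comm]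

theorem elemAb_unitIdeal {t : A} (ht : t ∈ unitIdeal A) : elemAb A t = 0 := by
  refine Submodule.span_induction (p := fun t _ => ∀ r : A, elemAb A (r * t) = 0)
    ?_ ?_ ?_ ?_ ht 1 |> fun h => by rwa [one_mul] at h
  · rintro _ ⟨a, rfl⟩ r
    rw [mul_sub, mul_one, map_sub, mul_comm, elemAb_unit_mul, sub_self]
  · intro r
    rw [mul_zero, map_zero]
  · intro x y _ _ hx hy r
    rw [mul_add, map_add, hx, hy, add_zero]
  · intro b x _ hx r
    rw [smul_eq_mul, ← mul_assoc]
    exact hx _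

/-- The map `A_{Aˣ} → H₁(PGE₂(A), ℤ)` that sends the class of `t` to the class of `E₁₂(t)`. -/
def elemH1 (A : Type u) [CommRing A] : AU A →+ HZ (PGE A) 1 :=
  (h1Class (PGE A)).comp
    (QuotientAddGroup.lift (unitIdeal A).toAddSubgroup (elemAb A) fun _ ht => elemAb_unitIdeal ht)

theorem elemH1_mk (t : A) : elemH1 A (Ideal.Quotient.mk (unitIdeal A) t) =
    h1Class (PGE A) (elemAb A t) := rfl

/-- The square class group `Aˣ / (Aˣ)²`. -/
abbrev SqCl (A : Type u) [CommRing A] : Type u := Aˣ ⧸ (powMonoidHom 2 : Aˣ →* Aˣ).range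

/-- The determinant `PGE₂(A) → Aˣ / (Aˣ)²`. -/
def detPGE (A : Type u) [CommRing A] : PGE A →* SqCl A :=
  QuotientGroup.lift ((scalars A).subgroupOf (GE A))
    ((QuotientGroup.mk' (powMonoidHom 2 : Aˣ →* Aˣ).range).comp
      (Matrix.GeneralLinearGroup.det.comp (GE A).subtype)) fun g hg => by
    obtain ⟨b, hb⟩ := Subgroup.mem_subgroupOf.1 hg
    refine (QuotientGroup.eq_one_iff _).2 ⟨b, ?_⟩
    change b ^ 2 = Matrix.GeneralLinearGroup.det (g : GL (Fin 2) A)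
    rw [← hb, scalar_eq_diag, det_diag, pow_two]

/-- The map `det_* : H₁(PGE₂(A), ℤ) → Aˣ / (Aˣ)²`. -/
def detH1 (A : Type u) [CommRing A] : HZ (PGE A) 1 →+ Additive (SqCl A) := h1Map (B := SqCl A) (detPGE A)

/-- The subgroup of `GSt(2, A)` generated by the lifts `(h₁₂(a⁻¹), d(a²))` of the scalar matrices.
Modulo `C(2, A)` it is central, and the kernel of `GSt(2, A) → PGE₂(A)` is generated by it and
`K₂(2, A)`. -/
def scalarLifts (A : Type u) [CommRing A] : Subgroup (GSt A) :=
  Subgroup.closure (Set.range fun a : Aˣ => scalarLift a)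

/-- The homomorphism `δ` is the connecting map of the extension
`1 → K₂(2, A)/C(2, A) → PGSt(2, A) → PGE₂(A) → 1`, where `PGSt(2, A)` is the quotient of
`GSt(2, A)` by `C(2, A)` and the lifts of the scalar matrices. For a set-theoretic section `s`
with factor set `c`, that is `s(g) s(h) = c(g, h) s(gh)` in `PGSt(2, A)`, it sends the class of a
2-cycle `∑ n_i (g_i, h_i)` to `∑ n_i [c(g_i, h_i)]`. -/
def IsConnecting (δ : HZ (PGE A) 2 →+ KCcoinv A) : Prop :=
  ∃ (s : PGE A → GSt A) (c : PGE A → PGE A → K2 A),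
    (∀ g, proj A (s g) = g) ∧
    (∀ g h, ∃ l ∈ scalarLifts A,
      s g * s h = SemidirectProduct.inl (c g h : St A) * l * s (g * h)) ∧
    ∀ x : groupHomology.cycles₂ (Rep.trivial (ULift.{u} ℤ) (PGE A) (ULift.{u} ℤ)),
      δ (groupHomology.H2π (Rep.trivial (ULift.{u} ℤ) (PGE A) (ULift.{u} ℤ)) x) =
        Finsupp.sum (x : PGE A × PGE A →₀ ULift.{u} ℤ)
          fun p n => n.down • kcClass (c p.1 p.2)

end Steinberg

end

end GETwo

/-!
The projection from `GSt(2, A)` to `PGE₂(A)` has kernel `N`, and every element of `N` is uniquely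
`k · (h₁₂(b⁻¹), b²)` with `k` in `K₂(2, A)` and `b` a unit (`exists_of_proj_eq_one`,
`inl_mul_scalarLift_inj`). Modulo `C(2, A)` the lifts of the scalar matrices multiply like units
and are central (`scalarLift_mul`, `conj_scalarLift`), so sending such an element to the class of
`k` is a homomorphism `kerClass` from `N` to the coinvariants, invariant under conjugation. The
quotient by `C(2, A)` and these lifts never has to be formed.

For any surjection `π : E → Q` and any conjugation-invariant homomorphism `θ : ker π → M`, the
factor set of a section of `π` gives a homomorphism `connecting : H₂(Q, ℤ) → M`. Two facts
describe its image. If `χ ∘ θ` extends to `E`, then `χ` kills the image, as `χ` of the factor set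
is then a coboundary (`map_connecting_eq_zero`). Conversely, a character of `M` that kills the
image is a coboundary on the factor set, because `ℚ/ℤ` is injective, and this makes its
composition with `θ` extend to `E` (`exists_extension_of_connecting_eq_zero`). As characters
separate points, `θ n` lies in the image as soon as no character of `E` detects `n`
(`exists_connecting_eq`). This is exactness of the five-term sequence at the coinvariants.

What remains is the abelianization of `GSt(2, A)`: on `St(2, A)`, every homomorphism from
`GSt(2, A)` to an abelian group factors through the map `f` to `A_{Aˣ}` (`exists_factor_fSt`), and
`f` extends to `GSt(2, A)` and restricts to `κ` on `N` (`fGSt_ker`). Hence an element of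
`K₂(2, A)` that `κ` kills is not detected by any character, and `f` modulo the image of `κ` is
defined on `PGE₂(A)`, which gives exactness at `A_{Aˣ}`. An element of `GSt(2, A)` whose
determinant is a square agrees in `PGE₂(A)ᵃᵇ` with an element of `St(2, A)`, since
`diag(a², 1)` is a scalar matrix times the image of `h₁₂(a)`; for the same reason `a ↦ diag(a, 1)`
defines the splitting.
-/

namespace GETwo

universe u

noncomputable section

/-! ### The connecting map of a group extension -/

/-- The differential `(g, h) ↦ h - gh + g` from the integral 2-chains to the integral 1-chains
of `Q`. -/
def boundaryZ (Q : Type u) [Group Q] : (Q × Q →₀ ULift.{u} ℤ) →+ (Q →₀ ULift.{u} ℤ) :=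
  (groupHomology.d₂₁ (Rep.trivial (ULift.{u} ℤ) Q (ULift.{u} ℤ))).hom.toAddMonoidHom

theorem boundaryZ_single {Q : Type u} [Group Q] (p : Q × Q) (n : ULift.{u} ℤ) :
    boundaryZ Q (Finsupp.single p n) =
      Finsupp.single p.2 n - Finsupp.single (p.1 * p.2) n + Finsupp.single p.1 n := by
  refine (groupHomology.d₂₁_single _ _).trans ?_
  rw [Representation.isTrivial_def, LinearMap.id_apply]

section Connecting

variable {E Q : Type u} [Group E] [Group Q] {π : E →* Q} {s : Q → E} (hs : ∀ g, π (s g) = g)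

/-- The factor set `s(g) s(h) s(gh)⁻¹` of a set-theoretic section `s` of `π`. -/
def factorSet (g h : Q) : π.ker :=
  ⟨s g * s h * (s (g * h))⁻¹, by simp [MonoidHom.mem_ker, hs]⟩

theorem factorSet_cocycle (g h k : Q) :
    MulAut.conjNormal (s g) (factorSet hs h k) * factorSet hs g (h * k) =
      factorSet hs g h * factorSet hs (g * h) k := by
  apply Subtype.ext
  simp [factorSet, mul_assoc]

/-- The element `n` of the kernel with `e = n s(π e)`. -/
def kerPart (e : E) : π.ker :=
  ⟨e * (s (π e))⁻¹, by simp [MonoidHom.mem_ker, hs]⟩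

theorem kerPart_mul (e f : E) :
    kerPart hs (e * f) =
      kerPart hs e * MulAut.conjNormal (s (π e)) (kerPart hs f) * factorSet hs (π e) (π f) := by
  apply Subtype.ext
  simp [kerPart, factorSet, mul_assoc]

variable {M : Type*} [AddCommGroup M] (θ : π.ker →* Multiplicative M)

/-- The homomorphism from the 2-chains of `Q` to `M` that sends `(g, h)` to `θ (c(g, h))`, where
`c` is the factor set of `s`. -/
def factorChain : (Q × Q →₀ ULift.{u} ℤ) →+ M :=
  Finsupp.liftAddHom fun p => (zmultiplesHom M (θ (factorSet hs p.1 p.2)).toAdd).comp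
    (AddEquiv.ulift : ULift.{u} ℤ ≃+ ℤ).toAddMonoidHom

theorem factorChain_apply (x : Q × Q →₀ ULift.{u} ℤ) :
    factorChain hs θ x = x.sum fun p n => n.down • (θ (factorSet hs p.1 p.2)).toAdd := rfl

theorem factorChain_single (p : Q × Q) (n : ULift.{u} ℤ) :
    factorChain hs θ (Finsupp.single p n) = n.down • (θ (factorSet hs p.1 p.2)).toAdd := by
  rw [factorChain_apply, Finsupp.sum_single_index]
  exact zero_smul ℤ _

/-- If `χ ∘ θ` extends to a homomorphism on `E`, then on 2-chains it factors through the
boundary, by way of the 1-cochain `F ∘ s`. -/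
theorem map_factorChain_eq {P : Type*} [AddCommGroup P] (χ : M →+ P)
    (F : E →* Multiplicative P) (hF : ∀ n : π.ker, (F n).toAdd = χ (θ n).toAdd)
    (x : Q × Q →₀ ULift.{u} ℤ) :
    χ (factorChain hs θ x) = Finsupp.liftAddHom (fun g => (zmultiplesHom P (F (s g)).toAdd).comp
      (AddEquiv.ulift : ULift.{u} ℤ ≃+ ℤ).toAddMonoidHom)
        (boundaryZ Q x) := by
  induction x using Finsupp.induction_linear with
  | zero => simp
  | add x y hx hy =>
    rw [map_add, map_add, hx, hy, map_add, map_add]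
  | single p n =>
    rw [boundaryZ_single, factorChain_single, map_zsmul, ← hF, map_add, map_sub]
    simp only [Finsupp.liftAddHom_apply_single]
    change _ = n.down • (F (s p.2)).toAdd - n.down • (F (s (p.1 * p.2))).toAdd +
      n.down • (F (s p.1)).toAdd
    rw [← smul_sub, ← smul_add]
    congr 1
    simp only [factorSet, map_mul, map_inv, toAdd_mul, toAdd_inv]
    abel

variable (hθ : ∀ e n, θ (MulAut.conjNormal e n) = θ n)

include hθ

theorem factorChain_d₃₂ (x : Q × Q × Q →₀ ULift.{u} ℤ) :
    factorChain hs θ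
      (groupHomology.d₃₂ (Rep.trivial (ULift.{u} ℤ) Q (ULift.{u} ℤ)) x) = 0 := by
  induction x using Finsupp.induction_linear with
  | zero => rw [map_zero]; exact map_zero _
  | add x y hx hy => rw [map_add]; exact (map_add _ _ _).trans (by rw [hx, hy, add_zero])
  | single p n =>
    obtain ⟨g, h, k⟩ := p
    have e := congrArg (fun m => (θ m).toAdd) (factorSet_cocycle hs g h k)
    simp only [map_mul, hθ, toAdd_mul] at e
    rw [groupHomology.d₃₂_single]
    refine (map_sub (factorChain hs θ) _ _).trans ?_
    rw [map_add, map_sub]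
    simp only [factorChain_single]
    rw [Representation.isTrivial_def, LinearMap.id_apply, ← smul_sub, ← smul_add, ← smul_sub,
      show _ - _ + _ - _ = (0 : M) by rw [sub_add_eq_add_sub, e]; abel, smul_zero]

/-- The homomorphism `H₂(Q, ℤ) → M` induced by `factorChain`. -/
def connecting : HZ Q 2 →+ M :=
  (groupHomology.H2π (Rep.trivial (ULift.{u} ℤ) Q (ULift.{u} ℤ))).hom.toAddMonoidHom.liftOfSurjective
    ((ModuleCat.epi_iff_surjective _).1 inferInstance)
    ⟨(factorChain hs θ).comp (groupHomology.cycles₂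
        (Rep.trivial (ULift.{u} ℤ) Q (ULift.{u} ℤ))).toAddSubgroup.subtype, fun x hx => by
      obtain ⟨y, hy⟩ := (groupHomology.H2π_eq_zero_iff x).1 hx
      refine (congrArg (factorChain hs θ) hy.symm).trans ?_
      exact factorChain_d₃₂ hs θ hθ y⟩

theorem connecting_H2π
    (x : groupHomology.cycles₂ (Rep.trivial (ULift.{u} ℤ) Q (ULift.{u} ℤ))) :
    connecting hs θ hθ (groupHomology.H2π (Rep.trivial (ULift.{u} ℤ) Q (ULift.{u} ℤ)) x) =
      factorChain hs θ x.1 :=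
  AddMonoidHom.liftOfRightInverse_comp_apply _ _ _ _ x

/-- A homomorphism `χ` such that `χ ∘ θ` extends to `E` kills the image of the connecting map. -/
theorem map_connecting_eq_zero {P : Type*} [AddCommGroup P] (χ : M →+ P)
    (F : E →* Multiplicative P) (hF : ∀ n : π.ker, (F n).toAdd = χ (θ n).toAdd) (x : HZ Q 2) :
    χ (connecting hs θ hθ x) = 0 := by
  induction x using groupHomology.H2_induction_on with
  | h x =>
    rw [connecting_H2π, map_factorChain_eq hs θ χ F hF, show boundaryZ Q x.1 = 0 from x.2,
      map_zero]

/-- A character of `M` that kills the image of the connecting map becomes, after composition with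
`θ`, the restriction of a character of `E`: its values on the factor set are the coboundary of a
1-cochain because `ℚ/ℤ` is injective. -/
theorem exists_extension_of_connecting_eq_zero (χ : M →+ AddCircle (1 : ℚ))
    (hχ : ∀ x, χ (connecting hs θ hθ x) = 0) :
    ∃ F : E →* Multiplicative (AddCircle (1 : ℚ)), ∀ n : π.ker, (F n).toAdd = χ (θ n).toAdd := by
  have hker : (boundaryZ Q).rangeRestrict.ker ≤ (χ.comp (factorChain hs θ)).ker := by
    intro x hx
    rw [AddMonoidHom.ker_rangeRestrict] at hx
    exact (congrArg χ (connecting_H2π hs θ hθ ⟨x, hx⟩)).symm.trans (hχ _)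
  obtain ⟨β, hβ⟩ := (Module.Baer.of_divisible (AddCircle (1 : ℚ))).extension_property_addMonoidHom
    (boundaryZ Q).range.subtype (boundaryZ Q).range.subtype_injective
    ((boundaryZ Q).rangeRestrict.liftOfSurjective (boundaryZ Q).rangeRestrict_surjective ⟨_, hker⟩)
  have hβd (x) : β (boundaryZ Q x) = χ (factorChain hs θ x) :=
    (DFunLike.congr_fun hβ ((boundaryZ Q).rangeRestrict x)).trans
      (AddMonoidHom.liftOfRightInverse_comp_apply _ _ _ _ x)
  set b : Q → AddCircle (1 : ℚ) := fun g => β (Finsupp.single g 1)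
  have hc (g h : Q) : χ (θ (factorSet hs g h)).toAdd = b h - b (g * h) + b g := by
    have h1 := hβd (Finsupp.single (g, h) 1)
    rw [boundaryZ_single, factorChain_single, map_add, map_sub] at h1
    exact ((congrArg χ (one_smul ℤ _)).symm.trans h1.symm)
  -- Multiplicativity is the coboundary equation `hc` together with `kerPart_mul`.
  refine ⟨MonoidHom.mk' (fun e => .ofAdd (χ (θ (kerPart hs e)).toAdd + b (π e))) ?_, ?_⟩
  · intro e f
    rw [kerPart_mul, map_mul θ, map_mul θ, hθ, toAdd_mul, toAdd_mul, map_add χ, map_add χ, hc,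
      map_mul π]
    refine Multiplicative.toAdd.injective ?_
    rw [toAdd_mul, toAdd_ofAdd, toAdd_ofAdd, toAdd_ofAdd]
    abel
  · intro n
    -- The section need not be normalized: the factor `s 1` is `factorSet hs 1 1`, and `b 1` absorbs it.
    have hn : n = kerPart hs (n : E) * factorSet hs 1 1 := by
      apply Subtype.ext
      simp [kerPart, factorSet, MonoidHom.mem_ker.1 n.2]
    have h1 : χ (θ n).toAdd = χ (θ (kerPart hs (n : E))).toAdd + b 1 := by
      conv_lhs => rw [hn, map_mul, toAdd_mul, map_add, hc]
      simp
    rw [h1]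
    simp [MonoidHom.mem_ker.1 n.2]

/-- An element of the kernel that no character of `E` detects is mapped by `θ` into the image of
the connecting map. -/
theorem exists_connecting_eq (n : π.ker)
    (hn : ∀ F : E →* Multiplicative (AddCircle (1 : ℚ)), F n = 1) :
    ∃ x, connecting hs θ hθ x = (θ n).toAdd := by
  by_contra h
  have h0 : (QuotientAddGroup.mk (θ n).toAdd : M ⧸ (connecting hs θ hθ).range) ≠ 0 := fun h1 =>
    h ((QuotientAddGroup.eq_zero_iff _).1 h1)
  obtain ⟨c, hc⟩ := CharacterModule.exists_character_apply_ne_zero_of_ne_zero h0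
  obtain ⟨F, hF⟩ := exists_extension_of_connecting_eq_zero hs θ hθ
    (AddMonoidHom.comp c (QuotientAddGroup.mk' (connecting hs θ hθ).range)) fun x => by
      have h2 : (QuotientAddGroup.mk (connecting hs θ hθ x) : M ⧸ (connecting hs θ hθ).range) = 0 :=
        (QuotientAddGroup.eq_zero_iff _).2 ⟨x, rfl⟩
      exact (congrArg c h2).trans (map_zero c)
  have h3 := hF n
  rw [hn F] at h3
  exact hc h3.symm

end Connecting
variable {A : Type u} [CommRing A]

/-! ### The kernel of `GSt(2, A) → PGE₂(A)` -/

instance C2_normal : (C2 A).Normal where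
  conj_mem n hn g := by
    rwa [Subgroup.mem_center_iff.1 (C2_le_center hn) g, mul_inv_cancel_right]

/-- Modulo the Steinberg symbols, `u ↦ h₁₂(u)` is a homomorphism. -/
def stHMod (A : Type u) [CommRing A] : Aˣ →* St A ⧸ C2 A :=
  MonoidHom.mk' (fun u => QuotientGroup.mk' (C2 A) (stH u)) fun u v => by
    have h : QuotientGroup.mk' (C2 A) (symb v u) = 1 :=
      (QuotientGroup.eq_one_iff _).2 (Subgroup.subset_closure ⟨(v, u), rfl⟩)
    rw [symb, map_mul, map_mul, map_inv, map_inv, mul_inv_eq_one, mul_inv_eq_iff_eq_mul] at h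
    rw [mul_comm u v, h]

theorem stHMod_apply (u : Aˣ) : stHMod A u = QuotientGroup.mk' (C2 A) (stH u) := rfl

@[simp]
theorem scalarLift_left (a : Aˣ) : (scalarLift a).left = stH a⁻¹ := rfl

@[simp]
theorem scalarLift_right (a : Aˣ) : (scalarLift a).right = a ^ 2 := rfl

theorem scalarLift_mul (a b : Aˣ) :
    ∃ c ∈ C2 A, scalarLift a * scalarLift b = SemidirectProduct.inl c * scalarLift (a * b) := by
  refine ⟨stH a⁻¹ * unitEnd (a ^ 2) (stH b⁻¹) * (stH (a * b)⁻¹)⁻¹, ?_, ?_⟩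
  · rw [← QuotientGroup.eq_one_iff]
    change QuotientGroup.mk' (C2 A) _ = 1
    rw [unitEnd_stH]
    simp only [map_mul, map_inv, ← stHMod_apply]
    simp only [← map_mul, ← map_inv]
    rw [mul_inv_cancel_comm, ← mul_inv, mul_inv_cancel, map_one]
  · ext
    · simp [← unitAct_apply]
    · simp [mul_pow]

theorem scalarLift_one : scalarLift (1 : Aˣ) = 1 := by
  ext
  · simp [stH, hElt, stW_neg]
  · simp

theorem scalarLift_mul_inl (b : Aˣ) (s : St A) :
    scalarLift b * SemidirectProduct.inl s = SemidirectProduct.inl s * scalarLift b := by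
  have h := inl_conjSt (scalarLift b) s
  rw [conjSt_scalarLift, MulAut.one_apply] at h
  exact (eq_mul_inv_iff_mul_eq.1 h).symm

/-- The lifts of the scalar matrices are central modulo `C(2, A)`: they commute with `St(2, A)`,
and conjugation by `a ∈ Aˣ` changes the lift of `b` by the Steinberg symbol `{a, b⁻¹}`. -/
theorem conj_scalarLift (g : GSt A) (b : Aˣ) :
    ∃ c ∈ C2 A, g * scalarLift b * g⁻¹ = SemidirectProduct.inl c * scalarLift b := by
  have hc : symb g.right b⁻¹ ∈ C2 A := Subgroup.subset_closure ⟨(g.right, b⁻¹), rfl⟩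
  have hr : SemidirectProduct.inr g.right * scalarLift b =
      SemidirectProduct.inl (symb g.right b⁻¹) * scalarLift b * SemidirectProduct.inr g.right := by
    ext
    · simp [unitAct_apply, unitEnd_stH, symb]
    · simp [mul_comm]
  have hs := Subgroup.mem_center_iff.1 (C2_le_center hc) g.left
  refine ⟨_, hc, ?_⟩
  rw [mul_inv_eq_iff_eq_mul]
  nth_rw 1 [← SemidirectProduct.inl_left_mul_inr_right g]
  rw [mul_assoc, hr, ← mul_assoc, ← mul_assoc, ← map_mul, hs, map_mul, mul_assoc
    (SemidirectProduct.inl _) (SemidirectProduct.inl _), ← scalarLift_mul_inl]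
  simp only [mul_assoc, SemidirectProduct.inl_left_mul_inr_right]

theorem Phi_inl_mul_scalarLift (k : K2 A) (b : Aˣ) :
    Phi A (SemidirectProduct.inl (k : St A) * scalarLift b) = diagGE b b := by
  have hk : phi A k = 1 := k.2
  have hb : Phi A (scalarLift b) = phi A (stH b⁻¹) * diagGE (b ^ 2) 1 := rfl
  have hi : Phi A (SemidirectProduct.inl (k : St A)) = 1 := by
    rw [Phi_apply, SemidirectProduct.left_inl, SemidirectProduct.right_inl, hk, map_one, one_mul]
  rw [map_mul, hi, hb, phi_stH, diagGE_mul, one_mul, inv_inv, mul_one, pow_two, inv_mul_cancel_left]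

theorem proj_inl_mul_scalarLift (k : K2 A) (b : Aˣ) :
    proj A (SemidirectProduct.inl (k : St A) * scalarLift b) = 1 := by
  refine (QuotientGroup.eq_one_iff _).2 (Subgroup.mem_subgroupOf.2 ⟨b, ?_⟩)
  rw [Phi_inl_mul_scalarLift, scalar_eq_diag]
  rfl

theorem exists_of_proj_eq_one {g : GSt A} (hg : proj A g = 1) :
    ∃ (k : K2 A) (b : Aˣ), g = SemidirectProduct.inl (k : St A) * scalarLift b := by
  obtain ⟨b, hb⟩ := Subgroup.mem_subgroupOf.1 ((QuotientGroup.eq_one_iff _).1 hg)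
  rw [scalar_eq_diag] at hb
  have hdet := congrArg Matrix.GeneralLinearGroup.det hb
  change _ = Matrix.GeneralLinearGroup.det ((Phi A g : GE A) : GL (Fin 2) A) at hdet
  rw [Phi_apply, Subgroup.coe_mul, map_mul, det_phi, det_diag, one_mul,
    show ((dHom A g.right : GE A) : GL (Fin 2) A) = diag g.right 1 from rfl, det_diag,
    mul_one] at hdet
  have hphi : phi A g.left * dHom A g.right = diagGE b b := Subtype.ext hb.symm
  have hk : g.left * (stH b⁻¹)⁻¹ ∈ K2 A := by
    change phi A _ = 1
    rw [map_mul, map_inv, mul_inv_eq_one, phi_stH, eq_mul_inv_of_mul_eq hphi,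
      mul_inv_eq_iff_eq_mul]
    change _ = diagGE _ _ * diagGE _ _
    rw [diagGE_mul, ← hdet]
    simp
  refine ⟨⟨_, hk⟩, b, ?_⟩
  ext
  · simp
  · simp [pow_two, hdet]

theorem inl_mul_scalarLift_inj {k l : K2 A} {a b : Aˣ}
    (h : SemidirectProduct.inl (k : St A) * scalarLift a =
      (SemidirectProduct.inl (l : St A) * scalarLift b : GSt A)) : k = l := by
  have h1 := congrArg (Phi A) h
  rw [Phi_inl_mul_scalarLift, Phi_inl_mul_scalarLift] at h1
  have h2 : a = b := by
    apply Units.ext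
    simpa [diagGE, diag] using congrArg (fun g : GE A => (g : GL (Fin 2) A) 0 0) h1
  rw [h2, mul_left_inj] at h
  exact Subtype.ext (SemidirectProduct.inl_injective h)

/-! ### The class of a kernel element in the coinvariants -/

theorem kcClass_mul (k l : K2 A) : kcClass (k * l) = kcClass k + kcClass l := by
  rw [kcClass, map_mul, ofMul_mul, map_add]
  rfl

theorem kcClass_of_mem_C2 {k : K2 A} (hk : (k : St A) ∈ C2 A) : kcClass k = 0 := by
  have h : QuotientGroup.mk' (C2K A) k = 1 := (QuotientGroup.eq_one_iff _).2 hk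
  rw [kcClass, kcMk, MonoidHom.comp_apply, h, map_one, ofMul_one, map_zero]

theorem kcClass_conjK2 (g : GSt A) (k : K2 A) : kcClass (conjK2 g k) = kcClass k := by
  rw [kcClass, ← gstAct_kcMk, ← pgeAct_proj, ← kcRep_apply]
  exact Representation.Coinvariants.mk_self_apply _ _ _

theorem kcClass_surjective : Function.Surjective (kcClass : K2 A → KCcoinv A) := by
  intro x
  obtain ⟨y, rfl⟩ := Representation.Coinvariants.mk_surjective (kcRep A) x
  obtain ⟨k, hk⟩ := kcMk_surjective (Additive.toMul y)
  exact ⟨k, by rw [kcClass, hk]; rfl⟩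

/-- The `K₂(2, A)`-component of an element of the kernel of `GSt(2, A) → PGE₂(A)`. -/
def kerK2 (n : (proj A).ker) : K2 A := (exists_of_proj_eq_one n.2).choose

theorem kerK2_spec (n : (proj A).ker) :
    ∃ b : Aˣ, (n : GSt A) = SemidirectProduct.inl (kerK2 n : St A) * scalarLift b :=
  (exists_of_proj_eq_one n.2).choose_spec

theorem kerK2_eq {n : (proj A).ker} {k : K2 A} {b : Aˣ}
    (h : (n : GSt A) = SemidirectProduct.inl (k : St A) * scalarLift b) : kerK2 n = k := by
  obtain ⟨a, ha⟩ := kerK2_spec n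
  exact inl_mul_scalarLift_inj (ha.symm.trans h)

/-- The homomorphism from the kernel of `GSt(2, A) → PGE₂(A)` to the coinvariants that is the
class map on `K₂(2, A)` and trivial on the lifts of the scalar matrices. -/
def kerClass (A : Type u) [CommRing A] : (proj A).ker →* Multiplicative (KCcoinv A) :=
  MonoidHom.mk' (fun n => .ofAdd (kcClass (kerK2 n))) fun m n => by
    obtain ⟨a, ha⟩ := kerK2_spec m
    obtain ⟨b, hb⟩ := kerK2_spec n
    obtain ⟨c, hc, h⟩ := scalarLift_mul a b
    have e : ((m * n : (proj A).ker) : GSt A) = SemidirectProduct.inl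
        ((kerK2 m * kerK2 n * ⟨c, C2_le_K2 hc⟩ : K2 A) : St A) * scalarLift (a * b) := by
      rw [Subgroup.coe_mul, ha, hb, mul_assoc, ← mul_assoc (scalarLift a), scalarLift_mul_inl,
        mul_assoc (SemidirectProduct.inl _) (scalarLift a), h]
      simp only [Subgroup.coe_mul, map_mul, mul_assoc]
    rw [kerK2_eq e, kcClass_mul, kcClass_mul, kcClass_of_mem_C2 (k := ⟨c, C2_le_K2 hc⟩) hc,
      add_zero, ofAdd_add]

theorem toAdd_kerClass (n : (proj A).ker) : (kerClass A n).toAdd = kcClass (kerK2 n) := rfl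

theorem kerClass_conj (g : GSt A) (n : (proj A).ker) :
    kerClass A (MulAut.conjNormal g n) = kerClass A n := by
  obtain ⟨b, hb⟩ := kerK2_spec n
  obtain ⟨c, hc, h⟩ := conj_scalarLift g b
  have e : ((MulAut.conjNormal g n : (proj A).ker) : GSt A) = SemidirectProduct.inl
      ((conjK2 g (kerK2 n) * ⟨c, C2_le_K2 hc⟩ : K2 A) : St A) * scalarLift b := by
    rw [MulAut.conjNormal_apply, hb, Subgroup.coe_mul, coe_conjK2, map_mul, inl_conjSt,
      mul_assoc _ _ (scalarLift b), ← h]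
    simp only [mul_assoc, inv_mul_cancel_left]
  apply Multiplicative.toAdd.injective
  rw [toAdd_kerClass, kerK2_eq e, kcClass_mul, kcClass_of_mem_C2 (k := ⟨c, C2_le_K2 hc⟩) hc,
    add_zero, kcClass_conjK2, toAdd_kerClass]

/-! ### The abelianization of `GSt(2, A)` -/

/-- The extension of `f : St(2, A) → A_{Aˣ}` to `GSt(2, A)` that is trivial on `Aˣ`. -/
def fGSt (A : Type u) [CommRing A] : GSt A →* Multiplicative (AU A) :=
  SemidirectProduct.lift (fSt A) 1 fun a => by
    refine MonoidHom.ext fun s => ?_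
    have h := fSt_conjSt (SemidirectProduct.inr a) s
    rw [conjSt_apply] at h
    simpa [unitAct_apply] using h

theorem fGSt_apply (g : GSt A) : fGSt A g = fSt A g.left := by
  simp [fGSt, SemidirectProduct.lift]

theorem fGSt_ker (n : (proj A).ker) : (fGSt A n).toAdd = kappa A (kerClass A n).toAdd := by
  obtain ⟨b, hb⟩ := kerK2_spec n
  rw [hb, map_mul, fGSt_apply, fGSt_apply, toAdd_kerClass, kappa_kcClass]
  change Multiplicative.toAdd (fSt A (kerK2 n : St A) * fSt A (stH b⁻¹)) = _
  rw [fSt_stH, mul_one]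

/-- On `St(2, A)`, every homomorphism from `GSt(2, A)` to an abelian group factors through `f`:
conjugation by `Aˣ` identifies `x₁₂(t)` with `x₁₂(a t)`, and conjugation by `w₁₂(1)` identifies
`x₂₁(t)` with `x₁₂(-t)`. -/
theorem exists_factor_fSt {B : Type*} [CommGroup B] (F : GSt A →* B) :
    ∃ F' : AU A →+ Additive B,
      ∀ s, Additive.ofMul (F (SemidirectProduct.inl s)) = F' (fSt A s).toAdd := by
  have hu (a : Aˣ) (t : A) : F (SemidirectProduct.inl (stX false (a * t))) =
      F (SemidirectProduct.inl (stX false t)) := by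
    have h := inl_conjSt (SemidirectProduct.inr a) (stX false t)
    have h' : conjSt A (SemidirectProduct.inr a) (stX false t) = stX false (a * t) := by
      simp [conjSt_apply, sc]
    rw [← h', h, map_mul, map_mul, map_inv, mul_inv_cancel_comm]
  let ψ : A →+ Additive B := AddMonoidHom.mk'
    (fun t => Additive.ofMul (F (SemidirectProduct.inl (stX false t)))) fun r s => by
      rw [stX_add, map_mul, map_mul, ofMul_mul]
  have hψ (t : A) (ht : t ∈ unitIdeal A) : ψ t = 0 := by
    refine Submodule.span_induction (p := fun t _ => ∀ r : A, ψ (r * t) = 0)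
      ?_ ?_ ?_ ?_ ht 1 |> fun h => by rwa [one_mul] at h
    · rintro _ ⟨a, rfl⟩ r
      rw [mul_sub, mul_one, map_sub, mul_comm, sub_eq_zero]
      exact congrArg Additive.ofMul (hu a r)
    · intro r
      rw [mul_zero, map_zero]
    · intro x y _ _ hx hy r
      rw [mul_add, map_add, hx, hy, add_zero]
    · intro b x _ hx r
      rw [smul_eq_mul, ← mul_assoc]
      exact hx _
  let F' : AU A →+ Additive B := QuotientAddGroup.lift (unitIdeal A).toAddSubgroup ψ hψ
  refine ⟨F', fun s => ?_⟩
  have h : F.comp SemidirectProduct.inl =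
      (AddMonoidHom.toMultiplicativeLeft F').comp (fSt A) := by
    apply st_hom_ext
    intro i t
    rw [MonoidHom.comp_apply, MonoidHom.comp_apply, fSt_stX]
    change _ = F (SemidirectProduct.inl (stX false t))
    cases i
    · rfl
    · have h := congrArg (fun s => F (SemidirectProduct.inl s)) (stX_conj false (1 : Aˣ) t)
      simp only [map_mul, map_inv, mul_inv_cancel_comm] at h
      have e : -((1 : Aˣ) : A) ^ 2 * t = ((-1 : Aˣ) : A) * t := by simp
      rw [e, hu] at h
      exact h
  exact congrArg Additive.ofMul (DFunLike.congr_fun h s)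

/-- The class in `PGE₂(A)ᵃᵇ` of the image of `s ∈ St(2, A)` is that of `E₁₂(t)`, for any `t` that
represents `f s`. -/
theorem elemAb_fSt (s : St A) {t : A}
    (h : Ideal.Quotient.mk (unitIdeal A) t = (fSt A s).toAdd) :
    elemAb A t = Additive.ofMul (Abelianization.of (proj A (SemidirectProduct.inl s))) := by
  obtain ⟨F', hF'⟩ := exists_factor_fSt (Abelianization.of.comp (proj A))
  have h1 := hF' (stX false t)
  rw [fSt_stX, toAdd_ofAdd, h, ← hF' s] at h1
  refine Eq.trans ?_ h1
  have h2 : Phi A (SemidirectProduct.inl (stX false t)) = elemGE false t := by simp [Phi, phi]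
  change _ = Additive.ofMul (Abelianization.of (QuotientGroup.mk' _ (Phi A _)))
  rw [h2]
  rfl

/-! ### The first homology group -/

theorem h1Class_surjective (G : Type u) [Group G] : Function.Surjective (h1Class G) := by
  intro x
  obtain ⟨y, rfl⟩ := (groupHomology.H1AddEquivOfIsTrivial
    (Rep.trivial (ULift.{u} ℤ) G (ULift.{u} ℤ))).symm.surjective x
  induction y using TensorProduct.induction_on with
  | zero => exact ⟨0, by simp⟩
  | add y z hy hz =>
    obtain ⟨y', hy⟩ := hy
    obtain ⟨z', hz⟩ := hz
    exact ⟨y' + z', by rw [map_add, hy, hz, map_add]⟩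
  | tmul g n =>
    refine ⟨n.down • g, ?_⟩
    have h : (g ⊗ₜ[ℤ] n : TensorProduct ℤ _ _) = (n.down • g) ⊗ₜ[ℤ] (1 : ULift.{u} ℤ) := by
      rw [TensorProduct.smul_tmul]
      congr 1
      ext
      simp
    rw [h]
    rfl

theorem exists_h1Class_of (G : Type u) [Group G] (x : HZ G 1) :
    ∃ g : G, h1Class G (Additive.ofMul (Abelianization.of g)) = x := by
  obtain ⟨y, rfl⟩ := h1Class_surjective G x
  obtain ⟨g, hg⟩ := QuotientGroup.mk_surjective (Additive.toMul y)
  exact ⟨g, congrArg (h1Class G) (congrArg Additive.ofMul hg)⟩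

theorem detPGE_proj (g : GSt A) : detPGE A (proj A g) = QuotientGroup.mk g.right := by
  have h : Matrix.GeneralLinearGroup.det ((Phi A g : GE A) : GL (Fin 2) A) = g.right := by
    rw [Phi_apply, Subgroup.coe_mul, map_mul, det_phi, one_mul,
      show ((dHom A g.right : GE A) : GL (Fin 2) A) = diag g.right 1 from rfl, det_diag, mul_one]
  exact congrArg QuotientGroup.mk h

/-- In `PGE₂(A)ᵃᵇ` the class of `diag(a², 1)` is trivial: up to a scalar matrix it is the image of
`h₁₂(a⁻¹)⁻¹`, on which `f` vanishes. -/
theorem of_proj_inr_sq (a : Aˣ) :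
    Abelianization.of (proj A (SemidirectProduct.inr (a ^ 2))) = 1 := by
  have h : (SemidirectProduct.inr (a ^ 2) : GSt A) =
      SemidirectProduct.inl (stH a⁻¹)⁻¹ * scalarLift a := by
    ext <;> simp [-map_pow]
  have h1 : proj A (scalarLift a) = 1 := by
    simpa using proj_inl_mul_scalarLift (1 : K2 A) a
  have h2 := elemAb_fSt (A := A) (stH a⁻¹)⁻¹ (t := 0) (by simp [fSt_stH])
  rw [h, map_mul, h1, mul_one]
  rw [map_zero] at h2
  exact (congrArg Additive.toMul h2).symm

/-! ### Exactness -/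

theorem exact_connecting_kappa {s : PGE A → GSt A} (hs : ∀ g, proj A (s g) = g) :
    Function.Exact (connecting hs (kerClass A) kerClass_conj) (kappa A) := by
  intro y
  constructor
  · intro hy
    obtain ⟨k, rfl⟩ := kcClass_surjective y
    have hn : (SemidirectProduct.inl (k : St A) : GSt A) =
        SemidirectProduct.inl (k : St A) * scalarLift 1 := by
      rw [scalarLift_one, mul_one]
    obtain ⟨x, hx⟩ := exists_connecting_eq hs (kerClass A) kerClass_conj
      ⟨SemidirectProduct.inl (k : St A), by rw [hn]; exact proj_inl_mul_scalarLift k 1⟩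
      fun F => by
        obtain ⟨F', hF'⟩ := exists_factor_fSt F
        have h := hF' k
        rw [kappa_kcClass] at hy
        rw [hy, map_zero] at h
        exact congrArg Additive.toMul h
    refine ⟨x, hx.trans ?_⟩
    rw [toAdd_kerClass, kerK2_eq (k := k) (b := 1) hn]
  · rintro ⟨x, rfl⟩
    exact map_connecting_eq_zero hs (kerClass A) kerClass_conj
      (kappa A).toAddMonoidHom (fGSt A) fGSt_ker x

theorem isConnecting_connecting {s : PGE A → GSt A} (hs : ∀ g, proj A (s g) = g) :
    IsConnecting (connecting hs (kerClass A) kerClass_conj) := by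
  refine ⟨s, fun g h => kerK2 (factorSet hs g h), hs, fun g h => ?_, fun x => ?_⟩
  · obtain ⟨b, hb⟩ := kerK2_spec (factorSet hs g h)
    exact ⟨scalarLift b, Subgroup.subset_closure ⟨b, rfl⟩, mul_inv_eq_iff_eq_mul.1 hb⟩
  · exact connecting_H2π hs (kerClass A) kerClass_conj x

theorem exact_kappa_elemH1 : Function.Exact (kappa A) (elemH1 A) := by
  intro y
  constructor
  · intro hy
    -- `f` modulo the image of `κ` descends to `PGE₂(A)`.
    let R : AddSubgroup (AU A) := (kappa A).toAddMonoidHom.range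
    let F : GSt A →* Multiplicative (AU A ⧸ R) :=
      (AddMonoidHom.toMultiplicative (QuotientAddGroup.mk' R)).comp (fGSt A)
    let F' : PGE A →* Multiplicative (AU A ⧸ R) :=
      (proj A).liftOfSurjective proj_surjective ⟨F, fun n hn => by
        refine congrArg Multiplicative.ofAdd ((QuotientAddGroup.eq_zero_iff _).2 ?_)
        exact ⟨(kerClass A ⟨n, hn⟩).toAdd, (fGSt_ker ⟨n, hn⟩).symm⟩⟩
    obtain ⟨t, rfl⟩ := Ideal.Quotient.mk_surjective y
    rw [elemH1_mk, elemAb_fSt (stX false t) (by rw [fSt_stX, toAdd_ofAdd])] at hy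
    have h := h1Map_h1Class F' (proj A (SemidirectProduct.inl (stX false t)))
    rw [hy, map_zero] at h
    have h2 : F' (proj A (SemidirectProduct.inl (stX false t))) =
        F (SemidirectProduct.inl (stX false t)) :=
      MonoidHom.liftOfRightInverse_comp_apply _ _ _ _ _
    rw [h2] at h
    have h3 : fGSt A (SemidirectProduct.inl (stX false t)) =
        .ofAdd (Ideal.Quotient.mk (unitIdeal A) t) := by
      rw [fGSt_apply, SemidirectProduct.left_inl, fSt_stX]
    have h4 : (QuotientAddGroup.mk (Ideal.Quotient.mk (unitIdeal A) t) : AU A ⧸ R) = 0 := by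
      have := congrArg (fun z => Multiplicative.toAdd (Additive.toMul z)) h.symm
      simpa [F, h3] using this
    exact (QuotientAddGroup.eq_zero_iff _).1 h4
  · rintro ⟨x, rfl⟩
    obtain ⟨k, rfl⟩ := kcClass_surjective x
    obtain ⟨t, ht⟩ := Ideal.Quotient.mk_surjective (kappa A (kcClass k))
    rw [← ht, elemH1_mk, elemAb_fSt (k : St A) ht]
    have h : proj A (SemidirectProduct.inl (k : St A)) = 1 := by
      have h1 : Phi A (SemidirectProduct.inl (k : St A)) = 1 := by
        have hk : phi A k = 1 := k.2
        simp [Phi_apply, hk]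
      rw [proj, MonoidHom.comp_apply, h1, map_one]
    rw [h, map_one, ofMul_one, map_zero]

theorem detH1_h1Class (g : GSt A) :
    detH1 A (h1Class (PGE A) (Additive.ofMul (Abelianization.of (proj A g)))) =
      Additive.ofMul (QuotientGroup.mk g.right) :=
  (h1Map_h1Class _ _).trans (congrArg Additive.ofMul (detPGE_proj g))

theorem exact_elemH1_detH1 : Function.Exact (elemH1 A) (detH1 A) := by
  intro y
  constructor
  · intro hy
    obtain ⟨q, rfl⟩ := exists_h1Class_of _ y
    obtain ⟨g, rfl⟩ := proj_surjective q
    rw [detH1_h1Class] at hy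
    obtain ⟨a, ha⟩ := (QuotientGroup.eq_one_iff _).1 (congrArg Additive.toMul hy)
    obtain ⟨t, ht⟩ := Ideal.Quotient.mk_surjective (fSt A g.left).toAdd
    refine ⟨Ideal.Quotient.mk _ t, ?_⟩
    rw [elemH1_mk, elemAb_fSt g.left ht]
    nth_rw 2 [← SemidirectProduct.inl_left_mul_inr_right g]
    rw [← ha, map_mul, map_mul, powMonoidHom_apply, of_proj_inr_sq, mul_one]
  · rintro ⟨x, rfl⟩
    obtain ⟨t, rfl⟩ := Ideal.Quotient.mk_surjective x
    rw [elemH1_mk, elemAb_fSt (stX false t) (by rw [fSt_stX, toAdd_ofAdd]), detH1_h1Class]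
    simp

/-- The splitting of `det_*`, induced by `a ↦ diag(a, 1)`. -/
def detSection (A : Type u) [CommRing A] : Additive (SqCl A) →+ HZ (PGE A) 1 :=
  (h1Class (PGE A)).comp (MonoidHom.toAdditive (QuotientGroup.lift _
    (Abelianization.of.comp ((proj A).comp SemidirectProduct.inr)) (by
      rintro _ ⟨a, rfl⟩
      exact of_proj_inr_sq a)))

theorem detH1_detSection (y : Additive (SqCl A)) : detH1 A (detSection A y) = y := by
  obtain ⟨a, ha⟩ := QuotientGroup.mk_surjective (Additive.toMul y)
  obtain rfl : y = Additive.ofMul (QuotientGroup.mk a) := by rw [ha]; rfl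
  refine (detH1_h1Class (SemidirectProduct.inr a)).trans ?_
  rw [SemidirectProduct.right_inr]

end
end GETwo

theorem mainTheorem4 (A : Type*) [CommRing A] :
    (∃ δ : GETwo.HZ (GETwo.PGE A) 2 →+ GETwo.KCcoinv A,
      GETwo.IsConnecting δ ∧ Function.Exact δ (GETwo.kappa A)) ∧
    Function.Exact (GETwo.kappa A) (GETwo.elemH1 A) ∧
    Function.Exact (GETwo.elemH1 A) (GETwo.detH1 A) ∧
    Function.Surjective (GETwo.detH1 A) ∧
    ∃ σ : Additive (GETwo.SqCl A) →+ GETwo.HZ (GETwo.PGE A) 1,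
      ∀ y, GETwo.detH1 A (σ y) = y := by
  obtain ⟨s, hs⟩ := (GETwo.proj_surjective (A := A)).hasRightInverse
  exact ⟨⟨_, GETwo.isConnecting_connecting hs, GETwo.exact_connecting_kappa hs⟩,
    GETwo.exact_kappa_elemH1, GETwo.exact_elemH1_detH1,
    fun y => ⟨_, GETwo.detH1_detSection y⟩, GETwo.detSection A, GETwo.detH1_detSection⟩
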